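/- Let $\mathcal H$ and $\mathcal G$ be real Hilbert spaces, let $\Gamma_0(\mathcal H)$ be the class of proper lower semicontinuous convex functions from $\mathcal H$ to $]-\infty,+\infty]$, and let $f^*(u)=\sup_{z}\,(\langle z,u\rangle-f(z))$ denote the conjugate of $f$. For $f\in\Gamma_0(\mathcal H)$, $\operatorname{prox}_f x$ is the unique minimizer of $z\mapsto f(z)+\frac12\|x-z\|^2$; $\iota_C$ is the indicator function of $C$ ($0$ on $C$, $+\infty$ elsewhere) and $\operatorname{proj}_C=\operatorname{prox}_{\iota_C}$ for $C$ nonempty, closed and convex. For $f\colon\mathcal H\to[-\infty,+\infty]$ set $0\odot f=\iota_{\overline{\operatorname{dom}}f}$, where $\operatorname{dom}f=\{z : f(z)<+\infty\}$, and $\xi\odot f=\xi f$ for $\xi\in{]0,+\infty[}$. Let $f^{\vee}$ be equal to $f$ where $-\infty<f<0$ and to $+\infty$ elsewhere, let $f^{\wedge}$ be equal to $f$ where $0<f<+\infty$ and to $+\infty$ elsewhere, and set $f^{\blacktriangledown}=(f^{\vee})^{**}$ and $f^{\blacktriangle}=(f^{\wedge})^{**}$. Let $\varphi\in\Gamma_0(\mathcal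 H)$ and let $s\colon\mathcal G\to[-\infty,+\infty]$ be such that $S=s^{-1}(]0,+\infty[)\neq\varnothing$. The perspective $\varphi\rhd s$ is the largest lower semicontinuous convex function on the Hilbert direct sum $\mathcal H\oplus\mathcal G$ that minorizes the function equal to $s(y)\varphi(x/s(y))$ if $0<s(y)<+\infty$ and to $+\infty$ otherwise. Let $x\in\mathcal H$, $y\in\mathcal G$ and $\gamma\in{]0,+\infty[}$. Then, in each of the following three cases, $\varphi\rhd s\in\Gamma_0(\mathcal H\oplus\mathcal G)$, and: (i) Suppose that $\varphi^*(\mathcal H)\subset[0,+\infty]$, $(\varphi^*)^{-1}(]0,+\infty[)\neq\varnothing$, and $-s\in\Gamma_0(\mathcal G)$. For $\eta\in[0,+\infty[$ set $u_\eta=\operatorname{prox}_{\frac{\eta}{\gamma}\odot\varphi^*}(x/\gamma)$ and, if $\varphi^*(u_\eta)<+\infty$, set $v_\eta=\operatorname{prox}_{\gamma\varphi^*(u_\eta)\odot(-s)^{\blacktriangledown}}\,y$. Then there exists a unique $\eta\in[0,+\infty[$ such that $$\varphi^*(u_\eta)<+\infty\quad\text{and}\quad(-s)^{\blacktriangledown}(v_\eta)+\eta=0,$$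 and, for this $\eta$, $\operatorname{prox}_{\gamma(\varphi\rhd s)}(x,y)=(x-\gamma u_\eta,\;v_\eta)$. (ii) Suppose that $\varphi^*(\mathcal H)\subset\{0,+\infty\}$. Then $\operatorname{prox}_{\gamma(\varphi\rhd s)}(x,y)=(\operatorname{prox}_{\gamma\varphi}x,\;\operatorname{proj}_{\overline{\operatorname{conv}}\,S}\,y)$. (iii) Suppose that $\varphi^*(\mathcal H)\subset{]-\infty,0]}\cup\{+\infty\}$, $(\varphi^*)^{-1}(]-\infty,0[)\neq\varnothing$, and $s\in\Gamma_0(\mathcal G)$. For $\eta\in[0,+\infty[$ set $v_\eta=\operatorname{prox}_{\gamma\eta\odot s^{\blacktriangle}}\,y$ and, if $s^{\blacktriangle}(v_\eta)<+\infty$, set $u_\eta=\operatorname{prox}_{\frac1\gamma s^{\blacktriangle}(v_\eta)\odot\varphi^*}(x/\gamma)$. Then there exists a unique $\eta\in[0,+\infty[$ such that $$s^{\blacktriangle}(v_\eta)<+\infty\quad\text{and}\quad\varphi^*(u_\eta)+\eta=0,$$ and, for this $\eta$, $\operatorname{prox}_{\gamma(\varphi\rhd s)}(x,y)=(x-\gamma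 u_\eta,\;v_\eta)$. -/

import Mathlib

noncomputable section

namespace Perspective

open Set

/-- The effective domain `{x | f x < +∞}`. -/
def dom {E : Type*} (f : E → EReal) : Set E := {x | f x < ⊤}

/-- The epigraph of an extended-real-valued function. -/
def epi {E : Type*} (f : E → EReal) : Set (E × ℝ) := {p | f p.1 ≤ (p.2 : EReal)}

open Classical in
/-- The indicator function of `C`: `0` on `C`, `+∞` elsewhere. -/
def ind {E : Type*} (C : Set E) (x : E) : EReal := if x ∈ C then 0 else ⊤

section Hilbert

variable {E : Type*} [NormedAddCommGroup E] [InnerProductSpace ℝ E]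

/-- `Gamma0 f`: the function `f` is proper, lower semicontinuous and convex. -/
structure Gamma0 (f : E → EReal) : Prop where
  ne_bot : ∀ x, f x ≠ ⊥
  exists_ne_top : ∃ x, f x ≠ ⊤
  lsc : LowerSemicontinuous f
  convex : Convex ℝ (epi f)

/-- The (Fenchel) conjugate `f*(u) = sup_x (⟪x, u⟫ - f x)`. -/
def conj (f : E → EReal) (u : E) : EReal := ⨆ x : E, ((inner ℝ x u : ℝ) : EReal) - f x

open Classical in
/-- The function `f^∨`, equal to `f` where `-∞ < f < 0` and to `+∞` elsewhere. -/
def negPart (f : E → EReal) (x : E) : EReal := if ⊥ < f x ∧ f x < 0 then f x else ⊤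

/-- The `▼` envelope of `f`: the biconjugate of `f^∨`. -/
def lowerEnv (f : E → EReal) : E → EReal := conj (conj (negPart f))

open Classical in
/-- The function `f^∧`, equal to `f` where `0 < f < +∞` and to `+∞` elsewhere. -/
def posPart (f : E → EReal) (x : E) : EReal := if 0 < f x ∧ f x < ⊤ then f x else ⊤

/-- The `▲` envelope of `f`: the biconjugate of `f^∧`. -/
def upperEnv (f : E → EReal) : E → EReal := conj (conj (posPart f))

/-- The operation `ξ ⊙ f` for a real `ξ ≥ 0`: the indicator function of the closure of `dom f`
if `ξ = 0`, and the pointwise product `ξ f` if `ξ > 0`. -/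
def rscale (ξ : ℝ) (f : E → EReal) (x : E) : EReal :=
  if ξ = 0 then ind (closure (dom f)) x else (ξ : EReal) * f x

/-- The objective `z ↦ f z + ½ ‖x - z‖²` that defines the proximity operator at `x`. -/
def proxObj (f : E → EReal) (x z : E) : EReal := f z + ((‖x - z‖ ^ 2 / 2 : ℝ) : EReal)

/-- `p` is the unique minimizer over `E` of `z ↦ f z + ½ ‖x - z‖²`, that is `p = prox_f x`. -/
def IsProx (f : E → EReal) (x p : E) : Prop :=
  (∀ z, proxObj f x p ≤ proxObj f x z) ∧
    ∀ q, (∀ z, proxObj f x q ≤ proxObj f x z) → q = p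

open Classical in
/-- The proximity operator: the unique minimizer of `z ↦ f z + ½ ‖x - z‖²`. (It exists whenever
`f` is proper, lower semicontinuous and convex on a Hilbert space; if there is no unique
minimizer, the value is conventionally `x`.) -/
def prox (f : E → EReal) (x : E) : E := if h : ∃ p, IsProx f x p then h.choose else x

theorem IsProx.prox_eq {f : E → EReal} {x p : E} (h : IsProx f x p) : prox f x = p := by
  have h' : ∃ p, IsProx f x p := ⟨p, h⟩
  rw [prox, dif_pos h']
  exact h.2 _ h'.choose_spec.1

/-- The projection onto `C`, as the proximity operator of the indicator function of `C`. -/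
def proj (C : Set E) : E → E := prox (ind C)

/-- The largest lower semicontinuous convex function minorizing `f`, obtained as the pointwise
supremum of all of them. -/
def lscConvexEnv (f : E → EReal) (x : E) : EReal :=
  ⨆ h ∈ {h : E → EReal | LowerSemicontinuous h ∧ Convex ℝ (epi h) ∧ ∀ z, h z ≤ f z}, h x

/-- The envelope is indeed the greatest lower semicontinuous convex minorant. -/
theorem isGreatest_lscConvexEnv (f : E → EReal) :
    IsGreatest {h : E → EReal | LowerSemicontinuous h ∧ Convex ℝ (epi h) ∧ ∀ z, h z ≤ f z}
      (lscConvexEnv f) := by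
  refine ⟨⟨?_, ?_, ?_⟩, ?_⟩
  · exact lowerSemicontinuous_biSup fun h hh => hh.1
  · have : epi (lscConvexEnv f) = ⋂ h ∈ {h : E → EReal | LowerSemicontinuous h ∧
        Convex ℝ (epi h) ∧ ∀ z, h z ≤ f z}, epi h := by
      ext p
      simp only [epi, lscConvexEnv, mem_ofPred_eq, iSup_le_iff, mem_iInter]
    rw [this]
    exact convex_iInter₂ fun h hh => hh.2.1
  · intro z
    exact iSup₂_le fun h hh => hh.2.2 z
  · intro h hh z
    exact le_iSup₂ (f := fun (h : E → EReal) (_ : h ∈ {h : E → EReal | LowerSemicontinuous h ∧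
      Convex ℝ (epi h) ∧ ∀ z, h z ≤ f z}) => h z) h hh

end Hilbert

section Perspective

variable {H G : Type*} [NormedAddCommGroup H] [InnerProductSpace ℝ H]
  [NormedAddCommGroup G] [InnerProductSpace ℝ G]

open Classical in
/-- The preperspective of the base function `φ` with respect to the scaling function `s`, on the
Hilbert direct sum of `H` and `G`: it is `s(y) φ(x / s(y))` if `0 < s(y) < +∞`, and `+∞`
otherwise. -/
def preperspective (φ : H → EReal) (s : G → EReal) (z : WithLp 2 (H × G)) : EReal :=
  if 0 < s z.snd ∧ s z.snd < ⊤ then s z.snd * φ ((s z.snd).toReal⁻¹ • z.fst) else ⊤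

/-- The perspective of `φ` with respect to `s`: the largest lower semicontinuous convex function
minorizing the preperspective. -/
def perspective (φ : H → EReal) (s : G → EReal) : WithLp 2 (H × G) → EReal :=
  lscConvexEnv (preperspective φ s)

end Perspective

end Perspective

end

/-! ### Epigraphs, conjugates and the Fenchel–Moreau theorem. -/

namespace Perspective

open Set Filter Topology

/-! Substituting `s(y) x` for the first variable shows that the conjugate of the preperspective at
`(u, w)` is `sup_{y ∈ S} ⟪y, w⟫ + s(y) φ*(u)` on `dom φ*`. In cases (i) and (iii) `φ*` has a
constant sign `ε = ±1` on its domain. Let `k` be `-ε s` on `S` and `+∞` elsewhere, so that `s φ* =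
-(ε φ*) k`. The coefficient `ε φ*(u)` is nonnegative, hence `k` may be replaced by `k**`, which is
the envelope `▼` or `▲` of the statement. Conjugating again, the perspective `F` is `F(x, y) = sup_u
⟪x, u⟫ + ε k**(y) φ*(u)` on `dom k**`.

A point `(p, q)` is `prox_{γF}(x, y)` iff Fenchel–Young is an equality at `(p, q)` and `(u, w) = ((x
- p)/γ, (y - q)/γ)`. The products `ε k**(q) φ*(u)` cancel in that equality, which splits into two
variational inequalities: `u` and `q` are proximal points of multiples of `φ*` and `k**`, with
coefficients `-ε k**(q)/γ` and `γ ε φ*(u)`. Existence of `prox_{γF}` thus gives a solution, with `η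
= -k**(q)` in (i) and `η = -φ*(u)` in (iii); uniqueness of `prox_{γF}` gives uniqueness of `η`. In
(ii) the product vanishes and the two variables decouple.

The carrying lemmas are `SignedPair.conj_preperspective_le_iff`, `SignedPair.perspective_le_iff` and
`Gamma0.isProx_rscale_iff_conj`. Values in `EReal` are handled through their real upper bounds, so
that all arithmetic stays in `ℝ`. -/

theorem ereal_le_of_forall_coe {a b : EReal} (h : ∀ c : ℝ, b ≤ c → a ≤ c) : a ≤ b :=
  EReal.le_of_forall_lt_iff_le.1 fun c hc => h c hc.le

theorem isClosed_epi_iff {E : Type*} [TopologicalSpace E] {f : E → EReal} :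
    IsClosed (epi f) ↔ LowerSemicontinuous f := by
  constructor
  · intro h
    have key : ∀ c : ℝ, IsClosed {x | f x ≤ c} := fun c =>
      h.preimage (f := fun x : E => (x, c)) (by fun_prop)
    rw [lowerSemicontinuous_iff_isClosed_preimage]
    intro c
    have : f ⁻¹' Iic c = ⋂ (r : ℝ) (_ : c ≤ r), {x | f x ≤ r} := by
      ext x
      simp only [mem_preimage, mem_Iic, mem_iInter, mem_ofPred_eq]
      exact ⟨fun hx r hr => hx.trans hr, fun hx => ereal_le_of_forall_coe hx⟩
    rw [this]
    exact isClosed_biInter fun r _ => key r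
  · intro h
    exact (lowerSemicontinuous_iff_isClosed_epigraph.1 h).preimage
      (f := fun p : E × ℝ => (p.1, (p.2 : EReal)))
      (continuous_fst.prodMk (continuous_coe_real_ereal.comp continuous_snd))

section

variable {E : Type*} [NormedAddCommGroup E] [InnerProductSpace ℝ E]

theorem Gamma0.of_isClosed_epi {f : E → EReal} (h₁ : ∀ x, f x ≠ ⊥) (h₂ : ∃ x, f x < ⊤)
    (h₃ : IsClosed (epi f)) (h₄ : Convex ℝ (epi f)) : Gamma0 f :=
  ⟨h₁, h₂.imp fun _ h => h.ne, isClosed_epi_iff.1 h₃, h₄⟩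

theorem Gamma0.coe_toReal {f : E → EReal} (hf : Gamma0 f) {x : E} (hx : f x < ⊤) :
    ((f x).toReal : EReal) = f x :=
  EReal.coe_toReal hx.ne (hf.ne_bot x)

theorem Gamma0.toReal_le {f : E → EReal} (hf : Gamma0 f) {x : E} {r : ℝ} (h : f x ≤ r) :
    (f x).toReal ≤ r :=
  EReal.toReal_le_toReal h (hf.ne_bot x) (EReal.coe_ne_top r)

theorem Gamma0.exists_le_coe {f : E → EReal} (hf : Gamma0 f) : ∃ x, ∃ r : ℝ, f x ≤ r := by
  obtain ⟨x, hx⟩ := hf.exists_ne_top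
  exact ⟨x, (f x).toReal, (hf.coe_toReal (lt_top_iff_ne_top.2 hx)).ge⟩

theorem Gamma0.convex_dom {f : E → EReal} (hf : Gamma0 f) : Convex ℝ (dom f) := by
  have : dom f = Prod.fst '' epi f := by
    ext x
    constructor
    · intro hx
      exact ⟨(x, (f x).toReal), (hf.coe_toReal hx).ge, rfl⟩
    · rintro ⟨p, hp, rfl⟩
      exact lt_of_le_of_lt hp (EReal.coe_lt_top _)
  rw [this]
  exact hf.convex.linear_image (LinearMap.fst ℝ E ℝ)

theorem convex_setOf_le {f : E → EReal} (hf : Convex ℝ (epi f)) (r : ℝ) :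
    Convex ℝ {x | f x ≤ r} := by
  intro x hx y hy a b ha hb hab
  have := hf (x := (x, r)) hx (y := (y, r)) hy ha hb hab
  have hr : a * r + b * r = r := by rw [← add_mul, hab, one_mul]
  simpa [epi, hr] using this

/-! ### Conjugates -/

theorem conj_le_coe_iff {f : E → EReal} {u : E} {c : ℝ} :
    conj f u ≤ c ↔ ∀ x, ∀ r : ℝ, f x ≤ r → inner ℝ x u - r ≤ c := by
  rw [conj, iSup_le_iff]
  refine forall_congr' fun x => ?_
  induction h : f x with
  | bot =>
    simp only [bot_le, true_imp_iff, EReal.coe_sub_bot, top_le_iff, EReal.coe_ne_top, false_iff,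
      not_forall]
    exact ⟨inner ℝ x u - c - 1, by linarith⟩
  | top => simp
  | coe a =>
    constructor
    · intro h r hr
      have h1 : inner ℝ x u - a ≤ c := by exact_mod_cast h
      have h2 : a ≤ r := by exact_mod_cast hr
      linarith
    · intro h
      exact_mod_cast h a le_rfl

theorem le_conj {f : E → EReal} {x u : E} {r c : ℝ} (hx : f x ≤ r) (hu : conj f u ≤ c) :
    inner ℝ x u - r ≤ c :=
  conj_le_coe_iff.1 hu x r hx

theorem epi_conj (f : E → EReal) :
    epi (conj f) = ⋂ (p : E × ℝ) (_ : f p.1 ≤ p.2), {q | inner ℝ p.1 q.1 - p.2 ≤ q.2} := by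
  ext q
  simp only [epi, mem_ofPred_eq, conj_le_coe_iff, mem_iInter, Prod.forall]

theorem isClosed_epi_conj (f : E → EReal) : IsClosed (epi (conj f)) := by
  rw [epi_conj]
  refine isClosed_biInter fun p _ => isClosed_le ?_ ?_ <;> fun_prop

theorem convex_epi_conj (f : E → EReal) : Convex ℝ (epi (conj f)) := by
  rw [epi_conj]
  refine convex_iInter₂ fun p _ => ?_
  intro x hx y hy a b ha hb hab
  simp only [mem_ofPred_eq, Prod.fst_add, Prod.smul_fst, Prod.snd_add, Prod.smul_snd,
    inner_add_right, inner_smul_right, smul_eq_mul] at hx hy ⊢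
  have : p.2 = a * p.2 + b * p.2 := by rw [← add_mul, hab, one_mul]
  nlinarith [mul_le_mul_of_nonneg_left hx ha, mul_le_mul_of_nonneg_left hy hb]

theorem conj_antitone {f g : E → EReal} (h : ∀ x, f x ≤ g x) (u : E) : conj g u ≤ conj f u :=
  ereal_le_of_forall_coe fun _ hc => conj_le_coe_iff.2 fun x r hx =>
    conj_le_coe_iff.1 hc x r ((h x).trans hx)

theorem conj_ne_bot {f : E → EReal} (hf : ∃ x, ∃ r : ℝ, f x ≤ r) (u : E) : conj f u ≠ ⊥ := by
  intro h
  obtain ⟨x, r, hx⟩ := hf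
  have h1 : conj f u ≤ ((inner ℝ x u - r - 1 : ℝ) : EReal) := by rw [h]; exact bot_le
  have := le_conj hx h1
  linarith

theorem conj_conj_le (f : E → EReal) (x : E) : conj (conj f) x ≤ f x :=
  ereal_le_of_forall_coe fun c hc => conj_le_coe_iff.2 fun u r hu => by
    have := le_conj hc hu
    rw [real_inner_comm]
    linarith

theorem Gamma0.conj_of_exists {f : E → EReal} (h₁ : ∃ x, ∃ r : ℝ, f x ≤ r)
    (h₂ : ∃ u, ∃ c : ℝ, conj f u ≤ c) : Gamma0 (conj f) := by
  refine .of_isClosed_epi (conj_ne_bot h₁) ?_ (isClosed_epi_conj f) (convex_epi_conj f)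
  obtain ⟨u, c, h⟩ := h₂
  exact ⟨u, h.trans_lt (EReal.coe_lt_top c)⟩

theorem Gamma0.conj_conj_of_exists {f : E → EReal} (h₁ : ∃ x, ∃ r : ℝ, f x ≤ r)
    (h₂ : ∃ u, ∃ c : ℝ, conj f u ≤ c) : Gamma0 (conj (conj f)) := by
  refine .conj_of_exists h₂ ?_
  obtain ⟨x, r, h⟩ := h₁
  exact ⟨x, r, (conj_conj_le f x).trans h⟩

theorem exists_conj_le_of_separation {f : E → EReal} {g x₀ : E} {b m r₀ : ℝ} (hb : 0 < b)
    (h₁ : ∀ x, ∀ r : ℝ, f x ≤ r → inner ℝ x g - r * b ≤ m) (h₂ : m < inner ℝ x₀ g - r₀ * b) :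
    ∃ u, ∃ c : ℝ, conj f u ≤ c ∧ r₀ < inner ℝ x₀ u - c := by
  refine ⟨b⁻¹ • g, b⁻¹ * m, conj_le_coe_iff.2 fun x r hx => ?_, ?_⟩
  · have := mul_le_mul_of_nonneg_left (h₁ x r hx) (inv_pos.2 hb).le
    rw [inner_smul_right]
    have h3 : b⁻¹ * (inner ℝ x g - r * b) = b⁻¹ * inner ℝ x g - r := by field_simp
    linarith
  · have := mul_lt_mul_of_pos_left h₂ (inv_pos.2 hb)
    rw [inner_smul_right]
    have h3 : b⁻¹ * (inner ℝ x₀ g - r₀ * b) = b⁻¹ * inner ℝ x₀ g - r₀ := by field_simp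
    linarith

/-- The envelope dominates the biconjugate, which never takes the value `⊥`. -/
theorem gamma0_lscConvexEnv {f : E → EReal} (h₁ : ∃ x, ∃ r : ℝ, f x ≤ r)
    (h₂ : ∃ u, ∃ c : ℝ, conj f u ≤ c) : Gamma0 (lscConvexEnv f) := by
  obtain ⟨⟨hl, hc, hle⟩, hg⟩ := isGreatest_lscConvexEnv f
  have hcc := Gamma0.conj_conj_of_exists h₁ h₂
  refine ⟨fun x hx => hcc.ne_bot x ?_, ?_, hl, hc⟩
  · exact le_bot_iff.1 (hx ▸ hg ⟨hcc.lsc, hcc.convex, conj_conj_le f⟩ x)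
  · obtain ⟨x, r, hx⟩ := h₁
    exact ⟨x, (((hle x).trans hx).trans_lt (EReal.coe_lt_top r)).ne⟩

variable [CompleteSpace E]

theorem exists_inner_separation {C : Set E} (hC : Convex ℝ C) (hC' : IsClosed C) {x : E}
    (hx : x ∉ C) : ∃ (g : E) (m : ℝ), (∀ z ∈ C, inner ℝ z g ≤ m) ∧ m < inner ℝ x g := by
  obtain ⟨l, m, h₁, h₂⟩ := geometric_hahn_banach_closed_point hC hC' hx
  have hl : ∀ z, inner ℝ z ((InnerProductSpace.toDual ℝ E).symm l) = l z := fun z => by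
    rw [real_inner_comm, InnerProductSpace.toDual_symm_apply]
  exact ⟨(InnerProductSpace.toDual ℝ E).symm l, m, fun z hz => by rw [hl]; exact (h₁ z hz).le,
    by rwa [hl]⟩

/-- Hahn–Banach in `E × ℝ` for the epigraph. The vertical coefficient has a sign because the
epigraph is unbounded upwards. -/
theorem Gamma0.exists_separation {f : E → EReal} (hf : Gamma0 f) {x₀ : E} {r₀ : ℝ}
    (h : (r₀ : EReal) < f x₀) : ∃ (g : E) (b m : ℝ), 0 ≤ b ∧
      (∀ x, ∀ r : ℝ, f x ≤ r → inner ℝ x g - r * b ≤ m) ∧ m < inner ℝ x₀ g - r₀ * b := by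
  obtain ⟨l, m, h₁, h₂⟩ := geometric_hahn_banach_closed_point hf.convex
    (isClosed_epi_iff.2 hf.lsc) (x := (x₀, r₀)) (by simpa [epi] using h)
  set g := (InnerProductSpace.toDual ℝ E).symm (l.comp (ContinuousLinearMap.inl ℝ E ℝ))
  have hl : ∀ z r, l (z, r) = inner ℝ z g - r * (-l (0, 1)) := fun z r => by
    have h1 : inner ℝ z g = l (z, 0) := by
      rw [real_inner_comm, InnerProductSpace.toDual_symm_apply]
      simp
    have h2 : (z, r) = (z, (0 : ℝ)) + r • ((0 : E), (1 : ℝ)) := by simp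
    rw [h1, h2, map_add, map_smul, smul_eq_mul]
    ring
  have hle : ∀ x, ∀ r : ℝ, f x ≤ r → inner ℝ x g - r * (-l (0, 1)) ≤ m := fun x r hx => by
    rw [← hl]; exact (h₁ (x, r) hx).le
  refine ⟨g, -l (0, 1), m, ?_, hle, by rwa [← hl]⟩
  by_contra! hneg
  obtain ⟨x₁, r₁, hx₁⟩ := hf.exists_le_coe
  set b := -l (0, 1)
  -- Climbing by `t` above `(x₁, r₁)` would push the functional past `m` if `b < 0`.
  set t := (|m - inner ℝ x₁ g + r₁ * b| + 1) / (-b)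
  have ht : 0 ≤ t := by apply div_nonneg <;> [positivity; linarith]
  have h3 := hle x₁ (r₁ + t) (hx₁.trans (by exact_mod_cast (by linarith : r₁ ≤ r₁ + t)))
  have h4 : t * (-b) = |m - inner ℝ x₁ g + r₁ * b| + 1 := by
    apply div_mul_cancel₀; linarith
  have := le_abs_self (m - inner ℝ x₁ g + r₁ * b)
  nlinarith

theorem Gamma0.exists_conj_le {f : E → EReal} (hf : Gamma0 f) : ∃ u, ∃ c : ℝ, conj f u ≤ c := by
  obtain ⟨x, hx⟩ := hf.exists_ne_top
  have hfx := hf.coe_toReal (lt_top_iff_ne_top.2 hx)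
  obtain ⟨g, b, m, hb, h₁, h₂⟩ := hf.exists_separation (x₀ := x) (r₀ := (f x).toReal - 1) (by
    rw [← hfx, EReal.toReal_coe]; exact_mod_cast sub_one_lt _)
  have h₃ := h₁ x _ hfx.ge
  -- The separated point lies below the graph over a point of the domain, so the hyperplane is not
  -- vertical.
  have hb' : 0 < b := by nlinarith
  obtain ⟨u, c, h, -⟩ := exists_conj_le_of_separation hb' h₁ h₂
  exact ⟨u, c, h⟩

theorem Gamma0.exists_conj_le_lt {f : E → EReal} (hf : Gamma0 f) {x₀ : E} {r₀ : ℝ}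
    (h : (r₀ : EReal) < f x₀) : ∃ u, ∃ c : ℝ, conj f u ≤ c ∧ r₀ < inner ℝ x₀ u - c := by
  obtain ⟨g, b, m, hb, h₁, h₂⟩ := hf.exists_separation h
  rcases hb.lt_or_eq with hb | rfl
  · exact exists_conj_le_of_separation hb h₁ h₂
  obtain ⟨u, c, hu⟩ := hf.exists_conj_le
  simp only [mul_zero, sub_zero] at h₁ h₂
  have hd : 0 < inner ℝ x₀ g - m := by linarith
  -- For a vertical hyperplane, a known affine minorant is tilted: adding `t` times the separating
  -- functional keeps it a minorant and lifts it above `r₀` at `x₀`.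
  set t := (|r₀ - inner ℝ x₀ u + c| + 1) / (inner ℝ x₀ g - m)
  have ht : 0 ≤ t := by positivity
  have ht' : t * (inner ℝ x₀ g - m) = |r₀ - inner ℝ x₀ u + c| + 1 := div_mul_cancel₀ _ hd.ne'
  refine ⟨u + t • g, c + t * m, conj_le_coe_iff.2 fun x r hx => ?_, ?_⟩
  · have h3 := le_conj hx hu
    have h4 := mul_le_mul_of_nonneg_left (h₁ x r hx) ht
    rw [inner_add_right, inner_smul_right]
    linarith
  · rw [inner_add_right, inner_smul_right]
    have := le_abs_self (r₀ - inner ℝ x₀ u + c)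
    linarith

/-- The Fenchel–Moreau theorem. -/
theorem Gamma0.conj_conj_eq {f : E → EReal} (hf : Gamma0 f) : conj (conj f) = f := by
  funext x
  refine le_antisymm (conj_conj_le f x) (ereal_le_of_forall_coe fun c hc => ?_)
  by_contra! h
  obtain ⟨u, d, hu, hlt⟩ := hf.exists_conj_le_lt h
  have := le_conj hu hc
  rw [real_inner_comm] at this
  linarith

theorem Gamma0.conj {f : E → EReal} (hf : Gamma0 f) : Gamma0 (conj f) :=
  .conj_of_exists hf.exists_le_coe hf.exists_conj_le

/-- The envelope lies in `Γ₀`, hence is its own biconjugate, and biconjugation is monotone. -/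
theorem lscConvexEnv_eq_conj_conj {f : E → EReal} (h₁ : ∃ x, ∃ r : ℝ, f x ≤ r)
    (h₂ : ∃ u, ∃ c : ℝ, Perspective.conj f u ≤ c) :
    lscConvexEnv f = Perspective.conj (Perspective.conj f) := by
  obtain ⟨⟨-, -, hle⟩, hg⟩ := isGreatest_lscConvexEnv f
  have hcc := Gamma0.conj_conj_of_exists h₁ h₂
  refine le_antisymm ?_ (hg ⟨hcc.lsc, hcc.convex, conj_conj_le f⟩)
  rw [← (gamma0_lscConvexEnv h₁ h₂).conj_conj_eq]
  exact conj_antitone (conj_antitone hle)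

end

end Perspective

/-! ### The operation `⊙` and proximity operators. -/

namespace Perspective

open Set Filter Topology

theorem ind_le_coe_iff {E : Type*} {C : Set E} {z : E} {t : ℝ} :
    ind C z ≤ t ↔ z ∈ C ∧ 0 ≤ t := by
  by_cases h : z ∈ C <;> simp [ind, h]

theorem coe_mul_le_coe_iff {ξ : ℝ} (hξ : 0 < ξ) {a : EReal} {t : ℝ} :
    ξ * a ≤ t ↔ a ≤ ((t / ξ : ℝ) : EReal) := by
  induction a with
  | bot => simp [EReal.coe_mul_bot_of_pos hξ]
  | top => simp only [EReal.coe_mul_top_of_pos hξ, top_le_iff, EReal.coe_ne_top]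
  | coe a =>
    rw [← EReal.coe_mul, EReal.coe_le_coe_iff, EReal.coe_le_coe_iff, le_div_iff₀ hξ, mul_comm]

theorem nonpos_of_forall_le_mul {A B : ℝ} (h : ∀ δ, 0 < δ → δ ≤ 1 → A ≤ δ * B) : A ≤ 0 := by
  have hlim : Tendsto (fun δ : ℝ => δ * B) (𝓝[>] 0) (𝓝 0) := by
    have : Tendsto (fun δ : ℝ => δ * B) (𝓝 0) (𝓝 (0 * B)) := tendsto_id.mul_const B
    rw [zero_mul] at this
    exact this.mono_left nhdsWithin_le_nhds
  refine ge_of_tendsto hlim ?_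
  filter_upwards [Ioc_mem_nhdsGT (zero_lt_one' ℝ)] with δ hδ using h δ hδ.1 hδ.2

section

variable {E : Type*} [NormedAddCommGroup E]

theorem rscale_eq_mul {f : E → EReal} {ξ : ℝ} (hξ : 0 < ξ) :
    rscale ξ f = fun z => (ξ : EReal) * f z := by
  funext z
  rw [rscale, if_neg hξ.ne']

theorem rscale_zero (f : E → EReal) : rscale 0 f = ind (closure (dom f)) := by
  funext z
  rw [rscale, if_pos rfl]

theorem rscale_le_iff_of_pos {f : E → EReal} {ξ : ℝ} (hξ : 0 < ξ) {z : E} {t : ℝ} :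
    rscale ξ f z ≤ t ↔ f z ≤ ((t / ξ : ℝ) : EReal) := by
  rw [rscale_eq_mul hξ, coe_mul_le_coe_iff hξ]

theorem rscale_zero_le_iff {f : E → EReal} {z : E} {t : ℝ} :
    rscale 0 f z ≤ t ↔ z ∈ closure (dom f) ∧ 0 ≤ t := by
  rw [rscale_zero, ind_le_coe_iff]

end

variable {E : Type*} [NormedAddCommGroup E] [InnerProductSpace ℝ E]

/-! ### Proximity operators -/

theorem norm_sub_sq_expand (x p z : E) :
    ‖x - z‖ ^ 2 = ‖x - p‖ ^ 2 - 2 * inner ℝ (z - p) (x - p) + ‖z - p‖ ^ 2 := by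
  have : x - z = (x - p) - (z - p) := by abel
  rw [this, norm_sub_sq_real, real_inner_comm]

/-- Expanding the square, the objective at `z` exceeds that at `p` by at least `‖z - p‖² / 2`, which
gives minimality and uniqueness together. -/
theorem IsProx.of_subgradient {f : E → EReal} {x p : E} {r : ℝ} (hr : f p = r)
    (h : ∀ z, ∀ t : ℝ, f z ≤ t → r + inner ℝ (z - p) (x - p) ≤ t) : IsProx f x p := by
  have hp : proxObj f x p = ((r + ‖x - p‖ ^ 2 / 2 : ℝ) : EReal) := by
    rw [proxObj, hr, EReal.coe_add]
  have key : ∀ z, ∀ c : ℝ, proxObj f x z ≤ c → r + ‖x - p‖ ^ 2 / 2 + ‖z - p‖ ^ 2 / 2 ≤ c := by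
    intro z c hc
    have hz : f z ≤ ((c - ‖x - z‖ ^ 2 / 2 : ℝ) : EReal) := by
      rw [EReal.coe_sub]
      exact EReal.le_sub_iff_add_le (by simp) (by simp) |>.2 hc
    have h1 := h z _ hz
    have h2 := norm_sub_sq_expand x p z
    linarith
  refine ⟨fun z => ereal_le_of_forall_coe fun c hc => ?_, fun q hq => ?_⟩
  · rw [hp]
    have := key z c hc
    have h2 := sq_nonneg ‖z - p‖
    exact_mod_cast (by linarith : r + ‖x - p‖ ^ 2 / 2 ≤ c)
  · have h1 := key q _ ((hq p).trans hp.le)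
    have h2 : ‖q - p‖ ^ 2 ≤ 0 := by linarith
    have h3 : ‖q - p‖ = 0 := pow_eq_zero_iff two_ne_zero |>.1 (le_antisymm h2 (sq_nonneg _))
    exact sub_eq_zero.1 (norm_eq_zero.1 h3)

/-- Compare `p` with `(1 - a) p + a z`, divide by `a` and let `a → 0`. -/
theorem subgradient_of_isMin {f : E → EReal} (hf : Convex ℝ (epi f)) {x p : E} {r : ℝ}
    (hr : f p ≤ r)
    (h : ∀ z, ∀ t : ℝ, f z ≤ t → r + ‖x - p‖ ^ 2 / 2 ≤ t + ‖x - z‖ ^ 2 / 2) {z : E} {t : ℝ}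
    (hz : f z ≤ t) : r + inner ℝ (z - p) (x - p) ≤ t := by
  have key : ∀ a : ℝ, 0 < a → a ≤ 1 →
      r + inner ℝ (z - p) (x - p) - t ≤ a * (‖z - p‖ ^ 2 / 2) := by
    intro a ha ha'
    have h1 : ((1 - a) • (p, r) + a • (z, t) : E × ℝ) ∈ epi f :=
      hf hr hz (by linarith) ha.le (by ring)
    have h2 := h _ _ h1
    have h3 := norm_sub_sq_expand x p ((1 - a) • (p, r) + a • (z, t) : E × ℝ).1
    have h4 : ((1 - a) • (p, r) + a • (z, t) : E × ℝ).1 - p = a • (z - p) := by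
      simp only [Prod.fst_add, Prod.smul_fst]
      module
    have h5 : ((1 - a) • (p, r) + a • (z, t) : E × ℝ).2 = (1 - a) * r + a * t := by simp
    rw [h4, inner_smul_left, norm_smul, mul_pow] at h3
    simp only [conj_trivial, Real.norm_eq_abs, sq_abs] at h3
    rw [h3, h5] at h2
    have : a * (r + inner ℝ (z - p) (x - p) - t) ≤ a * (a * (‖z - p‖ ^ 2 / 2)) := by nlinarith
    exact le_of_mul_le_mul_left this ha
  linarith [nonpos_of_forall_le_mul key]

theorem Gamma0.subgradient_of_isProx {f : E → EReal} (hf : Gamma0 f) {x p : E}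
    (h : IsProx f x p) :
    f p < ⊤ ∧ ∀ z, ∀ t : ℝ, f z ≤ t → (f p).toReal + inner ℝ (z - p) (x - p) ≤ t := by
  have hp : f p < ⊤ := by
    obtain ⟨z, t, hz⟩ := hf.exists_le_coe
    have h1 : proxObj f x z ≤ ((t + ‖x - z‖ ^ 2 / 2 : ℝ) : EReal) := by
      rw [EReal.coe_add]
      exact add_le_add_left hz _
    rw [lt_top_iff_ne_top]
    intro h2
    have h3 := (h.1 z).trans h1
    rw [proxObj, h2, EReal.top_add_coe] at h3
    exact EReal.coe_ne_top _ (top_le_iff.1 h3)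
  have hpr := hf.coe_toReal hp
  refine ⟨hp, fun z t hz => subgradient_of_isMin hf.convex hpr.ge (fun z t hz => ?_) hz⟩
  have h1 : proxObj f x z ≤ ((t + ‖x - z‖ ^ 2 / 2 : ℝ) : EReal) := by
    rw [EReal.coe_add]
    exact add_le_add_left hz _
  have h2 := (h.1 z).trans h1
  rw [proxObj, ← hpr] at h2
  exact_mod_cast h2

theorem gamma0_ind {C : Set E} (h₁ : C.Nonempty) (h₂ : IsClosed C) (h₃ : Convex ℝ C) :
    Gamma0 (ind C) := by
  have he : epi (ind C) = C ×ˢ Ici 0 := by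
    ext p
    exact ind_le_coe_iff
  refine .of_isClosed_epi (fun x => ?_) ?_ (he ▸ h₂.prod isClosed_Ici)
    (he ▸ h₃.prod (convex_Ici 0))
  · by_cases h : x ∈ C <;> simp [ind, h]
  · obtain ⟨x, hx⟩ := h₁
    exact ⟨x, by simp [ind, hx]⟩

theorem Gamma0.rscale {f : E → EReal} (hf : Gamma0 f) {ξ : ℝ} (hξ : 0 ≤ ξ) :
    Gamma0 (rscale ξ f) := by
  rcases hξ.eq_or_lt with rfl | hξ
  · have : Perspective.rscale 0 f = ind (closure (dom f)) := by
      funext x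
      rw [Perspective.rscale, if_pos rfl]
    rw [this]
    refine gamma0_ind ?_ isClosed_closure hf.convex_dom.closure
    obtain ⟨x, hx⟩ := hf.exists_ne_top
    exact ⟨x, subset_closure (lt_top_iff_ne_top.2 hx)⟩
  have he : epi (Perspective.rscale ξ f) =
      (LinearMap.prodMap LinearMap.id (ξ⁻¹ • LinearMap.id) : E × ℝ →ₗ[ℝ] E × ℝ) ⁻¹' epi f := by
    ext p
    change Perspective.rscale ξ f p.1 ≤ p.2 ↔ f p.1 ≤ ((ξ⁻¹ * p.2 : ℝ) : EReal)
    rw [rscale_le_iff_of_pos hξ, div_eq_inv_mul]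
  refine .of_isClosed_epi (fun x hx => ?_) ?_ ?_ ?_
  · have h1 : ∀ c : ℝ, f x ≤ c := fun c => by
      have := (rscale_le_iff_of_pos (f := f) hξ (z := x) (t := c * ξ)).1 (by rw [hx]; exact bot_le)
      rwa [mul_div_cancel_right₀ _ hξ.ne'] at this
    exact hf.ne_bot x (le_bot_iff.1 (ereal_le_of_forall_coe fun c _ => h1 c))
  · obtain ⟨x, r, hx⟩ := hf.exists_le_coe
    refine ⟨x, lt_of_le_of_lt ((rscale_le_iff_of_pos (t := r * ξ) hξ).2 ?_) (EReal.coe_lt_top _)⟩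
    rwa [mul_div_cancel_right₀ _ hξ.ne']
  · rw [he]
    exact (isClosed_epi_iff.2 hf.lsc).preimage
      (f := fun p : E × ℝ => (p.1, ξ⁻¹ * p.2)) (by fun_prop)
  · rw [he]
    exact hf.convex.linear_preimage _

/-- One criterion covers `ξ = 0` as well: there the inequality on `dom f` extends to its closure by
continuity of the inner product. -/
theorem Gamma0.isProx_rscale_iff {f : E → EReal} (hf : Gamma0 f) {ξ : ℝ} (hξ : 0 ≤ ξ) {x u : E}
    (hu : f u < ⊤) : IsProx (Perspective.rscale ξ f) x u ↔
      ∀ z, ∀ t : ℝ, f z ≤ t → ξ * (f u).toReal + inner ℝ (z - u) (x - u) ≤ ξ * t := by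
  have hur : Perspective.rscale ξ f u = ((ξ * (f u).toReal : ℝ) : EReal) := by
    by_cases h0 : ξ = 0
    · simp [Perspective.rscale, h0, ind, show u ∈ closure (dom f) from subset_closure hu]
    · rw [Perspective.rscale, if_neg h0, EReal.coe_mul, hf.coe_toReal hu]
  constructor
  · intro h z t hz
    have h1 := ((hf.rscale hξ).subgradient_of_isProx h).2 z (ξ * t)
    rw [hur, EReal.toReal_coe] at h1
    apply h1
    rcases hξ.eq_or_lt with rfl | hξ
    · exact rscale_zero_le_iff.2 ⟨subset_closure (hz.trans_lt (EReal.coe_lt_top t)), by simp⟩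
    · rwa [rscale_le_iff_of_pos hξ, mul_div_cancel_left₀ _ hξ.ne']
  · intro h
    refine IsProx.of_subgradient hur fun z t hz => ?_
    rcases hξ.eq_or_lt with rfl | hξ
    · obtain ⟨hz, ht⟩ := rscale_zero_le_iff.1 hz
      have hcl : IsClosed {z | inner ℝ (z - u) (x - u) ≤ 0} := by
        refine isClosed_le ?_ ?_ <;> fun_prop
      have : z ∈ {z | inner ℝ (z - u) (x - u) ≤ 0} := by
        refine closure_minimal (fun w hw => ?_) hcl hz
        have := h w _ (hf.coe_toReal hw).ge
        simpa using this
      simp only [mem_ofPred_eq] at this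
      linarith
    · rw [rscale_le_iff_of_pos hξ] at hz
      have := h z _ hz
      rwa [mul_div_cancel₀ _ hξ.ne'] at this

/-- Here `g = (x - p)/γ` must be a subgradient of `f` at `p`, i.e. equality holds in Fenchel–Young;
`r` and `d` are real bounds for its two terms. -/
theorem Gamma0.isProx_rscale_iff_conj {f : E → EReal} (hf : Gamma0 f) {γ : ℝ} (hγ : 0 < γ)
    {x p g : E} (hg : x - p = γ • g) : IsProx (Perspective.rscale γ f) x p ↔
      ∃ r d : ℝ, f p ≤ r ∧ Perspective.conj f g ≤ d ∧ r + d ≤ inner ℝ p g := by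
  constructor
  · intro h
    have hp : f p < ⊤ := by
      by_contra hp
      have h1 := ((hf.rscale hγ.le).subgradient_of_isProx h).1
      simp only [rscale_eq_mul hγ, not_lt_top_iff.1 hp, EReal.coe_mul_top_of_pos hγ] at h1
      exact h1.ne rfl
    refine ⟨(f p).toReal, inner ℝ p g - (f p).toReal, (hf.coe_toReal hp).ge,
      conj_le_coe_iff.2 fun z t hz => ?_, by linarith⟩
    have h1 := (hf.isProx_rscale_iff hγ.le hp).1 h z t hz
    rw [hg, inner_smul_right, ← mul_add] at h1
    have h2 := le_of_mul_le_mul_left h1 hγ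
    rw [inner_sub_left] at h2
    linarith
  · rintro ⟨r, d, hr, hd, hrd⟩
    refine (hf.isProx_rscale_iff hγ.le (hr.trans_lt (EReal.coe_lt_top r))).2 fun z t hz => ?_
    rw [hg, inner_smul_right, ← mul_add, inner_sub_left]
    refine mul_le_mul_of_nonneg_left ?_ hγ.le
    have h1 := le_conj hz hd
    have h2 := hf.toReal_le hr
    linarith

variable [CompleteSpace E]

/-- Direct method: a minimizing sequence is Cauchy by the parallelogram law, and its limit stays in
the closed epigraph. -/
theorem Gamma0.exists_isMin_proxObj {f : E → EReal} (hf : Gamma0 f) (x : E) :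
    ∃ p, ∃ r : ℝ, f p ≤ r ∧
      ∀ z, ∀ t : ℝ, f z ≤ t → r + ‖x - p‖ ^ 2 / 2 ≤ t + ‖x - z‖ ^ 2 / 2 := by
  set A : Set ℝ := (fun p : E × ℝ => p.2 + ‖x - p.1‖ ^ 2 / 2) '' epi f
  have hA : A.Nonempty := by
    obtain ⟨z, r, hz⟩ := hf.exists_le_coe
    exact ⟨_, (z, r), hz, rfl⟩
  have hbdd : BddBelow A := by
    obtain ⟨u, c, hu⟩ := hf.exists_conj_le
    -- The minimum over `z` of `⟪z, u⟫ - c + ‖x - z‖² / 2`.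
    refine ⟨inner ℝ x u - c - ‖u‖ ^ 2 / 2, ?_⟩
    rintro _ ⟨⟨z, r⟩, hz, rfl⟩
    have h1 := le_conj hz hu
    have h2 : 0 ≤ ‖(x - z) - u‖ ^ 2 := sq_nonneg _
    rw [norm_sub_sq_real, inner_sub_left] at h2
    simp only
    linarith
  set m := sInf A
  have hm : ∀ z, ∀ t : ℝ, f z ≤ t → m ≤ t + ‖x - z‖ ^ 2 / 2 := fun z t hz =>
    csInf_le hbdd ⟨(z, t), hz, rfl⟩
  have hex : ∀ n : ℕ, ∃ p : E × ℝ, f p.1 ≤ p.2 ∧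
      p.2 + ‖x - p.1‖ ^ 2 / 2 < m + 1 / ((n : ℝ) + 1) := fun n => by
    obtain ⟨_, ⟨p, hp, rfl⟩, h⟩ := exists_lt_of_csInf_lt hA
      (lt_add_of_pos_right m (Nat.one_div_pos_of_nat (α := ℝ) (n := n)))
    exact ⟨p, hp, h⟩
  choose p hp hpm using hex
  -- At the midpoint the objective drops by `‖p_n - p_k‖² / 8` below the average, yet is at least
  -- `m`.
  have hdist : ∀ n k, n ≤ k → dist (p n).1 (p k).1 ≤ Real.sqrt (8 * (1 / ((n : ℝ) + 1))) := by
    intro n k hnk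
    apply Real.le_sqrt_of_sq_le
    have h1 : ((1 / 2 : ℝ) • p n + (1 / 2 : ℝ) • p k : E × ℝ) ∈ epi f :=
      hf.convex (hp n) (hp k) (by norm_num) (by norm_num) (by norm_num)
    have h2 := hm _ _ h1
    have h3 : x - ((1 / 2 : ℝ) • p n + (1 / 2 : ℝ) • p k : E × ℝ).1 =
        (1 / 2 : ℝ) • ((x - (p n).1) + (x - (p k).1)) := by
      simp only [Prod.fst_add, Prod.smul_fst]
      module
    have h4 := parallelogram_law_with_norm ℝ (x - (p n).1) (x - (p k).1)
    have h5 : x - (p n).1 - (x - (p k).1) = (p k).1 - (p n).1 := by abel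
    rw [h3, norm_smul, mul_pow] at h2
    simp only [Prod.snd_add, Prod.smul_snd, smul_eq_mul, Real.norm_eq_abs, sq_abs] at h2
    rw [h5] at h4
    have h6 : (1 : ℝ) / ((k : ℝ) + 1) ≤ 1 / ((n : ℝ) + 1) := Nat.one_div_le_one_div hnk
    have h7 := hpm n
    have h8 := hpm k
    rw [dist_comm, dist_eq_norm]
    nlinarith
  have hlim0 : Tendsto (fun n : ℕ => (1 : ℝ) / ((n : ℝ) + 1)) atTop (𝓝 0) :=
    tendsto_one_div_add_atTop_nhds_zero_nat
  have hcau : CauchySeq fun n => (p n).1 := by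
    refine cauchySeq_of_le_tendsto_0' (fun n => Real.sqrt (8 * (1 / ((n : ℝ) + 1)))) hdist ?_
    have := (hlim0.const_mul 8).sqrt
    simpa only [mul_zero, Real.sqrt_zero] using this
  obtain ⟨q, hq⟩ := cauchySeq_tendsto_of_complete hcau
  have hJ : Tendsto (fun n => (p n).2 + ‖x - (p n).1‖ ^ 2 / 2) atTop (𝓝 m) := by
    refine tendsto_of_tendsto_of_tendsto_of_le_of_le tendsto_const_nhds
      (by simpa only [add_zero] using hlim0.const_add m) (fun n => hm _ _ (hp n))
      (fun n => (hpm n).le)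
  have hN : Tendsto (fun n => ‖x - (p n).1‖ ^ 2 / 2) atTop (𝓝 (‖x - q‖ ^ 2 / 2)) :=
    (((tendsto_const_nhds (x := x)).sub hq).norm.pow 2).div_const 2
  have hr : Tendsto (fun n => (p n).2) atTop (𝓝 (m - ‖x - q‖ ^ 2 / 2)) := by
    simpa only [add_sub_cancel_right] using hJ.sub hN
  refine ⟨q, m - ‖x - q‖ ^ 2 / 2, ?_, fun z t hz => ?_⟩
  · exact (isClosed_epi_iff.2 hf.lsc).mem_of_tendsto (hq.prodMk_nhds hr)
      (Eventually.of_forall hp)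
  · have := hm z t hz
    linarith

theorem Gamma0.exists_isProx {f : E → EReal} (hf : Gamma0 f) (x : E) : ∃ p, IsProx f x p := by
  obtain ⟨p, r, hp, h⟩ := hf.exists_isMin_proxObj x
  have hpr := hf.coe_toReal (hp.trans_lt (EReal.coe_lt_top r))
  refine ⟨p, .of_subgradient hpr.symm fun z t hz => ?_⟩
  have h1 := subgradient_of_isMin hf.convex hp h hz
  have h2 := hf.toReal_le hp
  linarith

theorem Gamma0.isProx_prox {f : E → EReal} (hf : Gamma0 f) (x : E) : IsProx f x (prox f x) := by
  obtain ⟨p, hp⟩ := hf.exists_isProx x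
  rwa [hp.prox_eq]

end Perspective

/-! ### Conjugates and proximity operators of perspectives. -/

namespace Perspective

open Set Filter Topology

variable {H : Type*} [NormedAddCommGroup H] [InnerProductSpace ℝ H]

theorem preperspective_le_coe_iff {G : Type*} {φ : H → EReal} {s : G → EReal}
    {z : WithLp 2 (H × G)} {r : ℝ} :
    preperspective φ s z ≤ r ↔ (0 < s z.snd ∧ s z.snd < ⊤) ∧
      φ ((s z.snd).toReal⁻¹ • z.fst) ≤ ((r / (s z.snd).toReal : ℝ) : EReal) := by
  by_cases h : 0 < s z.snd ∧ s z.snd < ⊤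
  · have h1 : ((s z.snd).toReal : EReal) = s z.snd :=
      EReal.coe_toReal h.2.ne (bot_le.trans_lt h.1).ne'
    have h2 : 0 < (s z.snd).toReal := EReal.toReal_pos h.1 h.2.ne
    rw [preperspective, if_pos h, ← coe_mul_le_coe_iff h2, h1]
    simp [h]
  · rw [preperspective, if_neg h]
    simp [h]

theorem exists_preperspective_le {G : Type*} {φ : H → EReal}
    (hφ : ∃ x, ∃ r : ℝ, φ x ≤ r) {s : G → EReal} (hS : (s ⁻¹' Ioo 0 ⊤).Nonempty) :
    ∃ z, ∃ r : ℝ, preperspective φ s z ≤ r := by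
  obtain ⟨x, r, hx⟩ := hφ
  obtain ⟨y, hy⟩ := hS
  have hσ : 0 < (s y).toReal := EReal.toReal_pos hy.1 hy.2.ne
  refine ⟨WithLp.toLp 2 ((s y).toReal • x, y), (s y).toReal * r,
    preperspective_le_coe_iff.2 ⟨hy, ?_⟩⟩
  simp only [WithLp.toLp_snd, WithLp.toLp_fst]
  rwa [smul_smul, inv_mul_cancel₀ hσ.ne', one_smul, mul_div_cancel_left₀ _ hσ.ne']

variable {G : Type*} [NormedAddCommGroup G] [InnerProductSpace ℝ G]

theorem inner_eq_fst_add_snd (z w : WithLp 2 (H × G)) :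
    inner ℝ z w = inner ℝ z.fst w.fst + inner ℝ z.snd w.snd :=
  WithLp.prod_inner_apply z w

/-! ### The conjugate of the preperspective -/

theorem conj_preperspective_le_coe_iff {φ : H → EReal} (hφ : ∃ x, ∃ r : ℝ, φ x ≤ r)
    {s : G → EReal} (hS : (s ⁻¹' Ioo 0 ⊤).Nonempty) {z : WithLp 2 (H × G)} {c : ℝ} :
    conj (preperspective φ s) z ≤ c ↔ conj φ z.fst < ⊤ ∧ ∀ y, 0 < s y → s y < ⊤ →
      inner ℝ y z.snd + (s y).toReal * (conj φ z.fst).toReal ≤ c := by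
  have hbot := conj_ne_bot hφ z.fst
  constructor
  · intro h
    have key : ∀ y, 0 < s y → s y < ⊤ →
        conj φ z.fst ≤ (((c - inner ℝ y z.snd) / (s y).toReal : ℝ) : EReal) := by
      intro y hy hy'
      have hσ : 0 < (s y).toReal := EReal.toReal_pos hy hy'.ne
      refine conj_le_coe_iff.2 fun x r hx => ?_
      have h1 : preperspective φ s (WithLp.toLp 2 ((s y).toReal • x, y)) ≤
          (((s y).toReal * r : ℝ) : EReal) := by
        refine preperspective_le_coe_iff.2 ⟨⟨hy, hy'⟩, ?_⟩
        simp only [WithLp.toLp_snd, WithLp.toLp_fst]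
        rwa [smul_smul, inv_mul_cancel₀ hσ.ne', one_smul, mul_div_cancel_left₀ _ hσ.ne']
      have h2 := le_conj h1 h
      rw [inner_eq_fst_add_snd] at h2
      simp only [WithLp.toLp_fst, WithLp.toLp_snd, inner_smul_left, conj_trivial] at h2
      rw [le_div_iff₀ hσ]
      linarith
    obtain ⟨y₀, hy₀⟩ := hS
    have htop : conj φ z.fst < ⊤ := (key y₀ hy₀.1 hy₀.2).trans_lt (EReal.coe_lt_top _)
    refine ⟨htop, fun y hy hy' => ?_⟩
    have h1 := key y hy hy'
    rw [← EReal.coe_toReal htop.ne hbot, EReal.coe_le_coe_iff,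
      le_div_iff₀ (EReal.toReal_pos hy hy'.ne)] at h1
    linarith
  · rintro ⟨htop, h⟩
    refine conj_le_coe_iff.2 fun q r hq => ?_
    obtain ⟨⟨hy, hy'⟩, hq⟩ := preperspective_le_coe_iff.1 hq
    have hσ : 0 < (s q.snd).toReal := EReal.toReal_pos hy hy'.ne
    have h1 := le_conj hq (EReal.coe_toReal htop.ne hbot).ge
    have h2 := h q.snd hy hy'
    rw [inner_smul_left, conj_trivial] at h1
    have h3 : (s q.snd).toReal * ((s q.snd).toReal⁻¹ * inner ℝ q.fst z.fst -
        r / (s q.snd).toReal) = inner ℝ q.fst z.fst - r := by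
      field_simp
    have h4 := mul_le_mul_of_nonneg_left h1 hσ.le
    rw [h3] at h4
    rw [inner_eq_fst_add_snd]
    linarith

/-- An affine bound `⟪·, w⟫ - c ≤ a k`, possibly with `a = 0`, passes to the biconjugate of `k`. -/
theorem inner_sub_le_of_conj_conj_le {k : G → EReal} (hk : ∃ w, ∃ c : ℝ, conj k w ≤ c) {w : G}
    {a c : ℝ} (ha : 0 ≤ a) (h : ∀ v, ∀ r : ℝ, k v ≤ r → inner ℝ v w - a * r ≤ c) {v : G} {r : ℝ}
    (hv : conj (conj k) v ≤ r) : inner ℝ v w - a * r ≤ c := by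
  obtain ⟨w₀, c₀, h₀⟩ := hk
  -- Adding `δ` times a fixed affine bound makes the coefficient `a + δ` positive, so one can divide
  -- by it and get a point of the epigraph of `conj k`; then `δ → 0`.
  have key : ∀ δ : ℝ, 0 < δ → δ ≤ 1 →
      inner ℝ v w - a * r - c ≤ δ * (r + c₀ - inner ℝ v w₀) := by
    intro δ hδ _
    have hpos : 0 < a + δ := by linarith
    have h1 : conj k ((a + δ)⁻¹ • (w + δ • w₀)) ≤ (((a + δ)⁻¹ * (c + δ * c₀) : ℝ) : EReal) := by
      refine conj_le_coe_iff.2 fun v r hv => ?_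
      have h2 := h v r hv
      have h3 := mul_le_mul_of_nonneg_left (le_conj hv h₀) hδ.le
      rw [inner_smul_right, inner_add_right, inner_smul_right, inv_mul_eq_div, inv_mul_eq_div,
        div_sub' hpos.ne', div_le_div_iff_of_pos_right hpos]
      linarith
    have h2 := le_conj h1 hv
    rw [real_inner_comm, inner_smul_right, inner_add_right, inner_smul_right, inv_mul_eq_div,
      inv_mul_eq_div, ← sub_div, div_le_iff₀ hpos] at h2
    linarith
  linarith [nonpos_of_forall_le_mul key]

/-- The domain of the biconjugate of `k` lies in every closed convex set that contains that
of `k`. -/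
theorem dom_conj_conj_subset [CompleteSpace G] {k : G → EReal}
    (hk : ∃ w, ∃ c : ℝ, conj k w ≤ c) (hk' : ∀ v, conj (conj k) v ≠ ⊥) {C : Set G}
    (hC : Convex ℝ C) (hC' : IsClosed C) (hdom : ∀ v, k v < ⊤ → v ∈ C) {v : G}
    (hv : conj (conj k) v < ⊤) : v ∈ C := by
  by_contra hvC
  obtain ⟨g, m, h₁, h₂⟩ := exists_inner_separation hC hC' hvC
  -- The separating half-space is an affine bound with `a = 0`.
  have := inner_sub_le_of_conj_conj_le hk (w := g) (c := m) le_rfl (fun v r hv => by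
    simpa using h₁ v (hdom v (hv.trans_lt (EReal.coe_lt_top r))))
    (EReal.coe_toReal hv.ne (hk' v)).ge
  linarith

/-! ### The proximity operator of a perspective whose base conjugate has constant sign -/

/-- The setting of a base function `φ` whose conjugate has the sign `ε` and of a scaling function
`s` such that `-ε s`, restricted to `{0 < s < ∞}`, is the function `k`. -/
structure SignedPair (φ : H → EReal) (s k : G → EReal) (ε : ℝ) : Prop where
  gamma0 : Gamma0 φ
  nonempty : (s ⁻¹' Ioo 0 ⊤).Nonempty
  sq : ε * ε = 1
  le_iff : ∀ y, ∀ r : ℝ, k y ≤ r ↔ (0 < s y ∧ s y < ⊤) ∧ -ε * (s y).toReal ≤ r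
  nonneg : ∀ u, conj φ u < ⊤ → 0 ≤ ε * (conj φ u).toReal
  nonpos : ∀ v, conj (conj k) v < ⊤ → ε * (conj (conj k) v).toReal ≤ 0
  exists_pos : ∃ u, conj φ u < ⊤ ∧ 0 < ε * (conj φ u).toReal
  exists_conj_le : ∃ w, ∃ c : ℝ, conj k w ≤ c

namespace SignedPair

variable {φ : H → EReal} {s k : G → EReal} {ε : ℝ}

theorem exists_le (h : SignedPair φ s k ε) : ∃ y, ∃ r : ℝ, k y ≤ r := by
  obtain ⟨y, hy⟩ := h.nonempty
  exact ⟨y, _, (h.le_iff y _).2 ⟨hy, le_rfl⟩⟩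

theorem gamma0_biconj (h : SignedPair φ s k ε) : Gamma0 (conj (conj k)) :=
  .conj_conj_of_exists h.exists_le h.exists_conj_le

/-- The nonnegative coefficient `ε φ*(u)` lets the bound pass from `k` to its biconjugate; `ε * ε =
1` turns `(ε φ*)(-ε s)` into `-s φ*`. -/
theorem conj_preperspective_le_iff (h : SignedPair φ s k ε) {z : WithLp 2 (H × G)} {c : ℝ} :
    conj (preperspective φ s) z ≤ c ↔ conj φ z.fst < ⊤ ∧ ∀ v, ∀ r : ℝ, conj (conj k) v ≤ r →
      inner ℝ v z.snd - ε * (conj φ z.fst).toReal * r ≤ c := by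
  rw [conj_preperspective_le_coe_iff h.gamma0.exists_le_coe h.nonempty]
  refine and_congr_right fun htop => ⟨fun h1 v r hv => ?_, fun h1 y hy hy' => ?_⟩
  · refine inner_sub_le_of_conj_conj_le h.exists_conj_le (h.nonneg _ htop) (fun v r hv => ?_) hv
    obtain ⟨hs, hr⟩ := (h.le_iff v r).1 hv
    have h2 := h1 v hs.1 hs.2
    have h3 := mul_le_mul_of_nonneg_left hr (h.nonneg _ htop)
    have h4 : ε * (conj φ z.fst).toReal * (-ε * (s v).toReal) =
        -(ε * ε) * ((s v).toReal * (conj φ z.fst).toReal) := by ring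
    rw [h4, h.sq] at h3
    linarith
  · have h2 := h1 y _ ((conj_conj_le k y).trans ((h.le_iff y _).2 ⟨⟨hy, hy'⟩, le_rfl⟩))
    have h4 : ε * (conj φ z.fst).toReal * (-ε * (s y).toReal) =
        -(ε * ε) * ((s y).toReal * (conj φ z.fst).toReal) := by ring
    rw [h4, h.sq] at h2
    linarith

theorem exists_conj_preperspective_le (h : SignedPair φ s k ε) :
    ∃ z, ∃ c : ℝ, conj (preperspective φ s) z ≤ c := by
  obtain ⟨u, hu, hpos⟩ := h.exists_pos
  obtain ⟨w, c, hw⟩ := h.exists_conj_le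
  refine ⟨WithLp.toLp 2 (u, (ε * (conj φ u).toReal) • w), ε * (conj φ u).toReal * c,
    h.conj_preperspective_le_iff.2 ⟨hu, fun v r hv => ?_⟩⟩
  have h1 := mul_le_mul_of_nonneg_left (le_conj hw hv) hpos.le
  simp only [WithLp.toLp_snd, WithLp.toLp_fst, inner_smul_right]
  rw [real_inner_comm] at h1
  linarith

theorem gamma0_perspective (h : SignedPair φ s k ε) : Gamma0 (perspective φ s) :=
  gamma0_lscConvexEnv (exists_preperspective_le h.gamma0.exists_le_coe h.nonempty)
    h.exists_conj_preperspective_le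

variable [CompleteSpace H] [CompleteSpace G]

theorem perspective_eq (h : SignedPair φ s k ε) :
    perspective φ s = conj (conj (preperspective φ s)) :=
  lscConvexEnv_eq_conj_conj (exists_preperspective_le h.gamma0.exists_le_coe h.nonempty)
    h.exists_conj_preperspective_le

theorem conj_perspective (h : SignedPair φ s k ε) :
    conj (perspective φ s) = conj (preperspective φ s) := by
  rw [h.perspective_eq]
  exact (Gamma0.conj_of_exists (exists_preperspective_le h.gamma0.exists_le_coe h.nonempty)
    h.exists_conj_preperspective_le).conj_conj_eq

theorem perspective_le_iff (h : SignedPair φ s k ε) {z : WithLp 2 (H × G)} {c : ℝ} :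
    perspective φ s z ≤ c ↔ conj (conj k) z.snd < ⊤ ∧ ∀ u, ∀ r : ℝ, conj φ u ≤ r →
      inner ℝ z.fst u + ε * (conj (conj k) z.snd).toReal * r ≤ c := by
  rw [h.perspective_eq]
  constructor
  · intro hz
    -- Testing against `(u, a w)` with `a = ε φ*(u) > 0` and varying `w` recovers `k**` at the
    -- second component.
    have key : ∀ u, conj φ u < ⊤ → 0 < ε * (conj φ u).toReal → conj (conj k) z.snd ≤
        (((c - inner ℝ z.fst u) / (ε * (conj φ u).toReal) : ℝ) : EReal) := by
      intro u hu hpos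
      refine conj_le_coe_iff.2 fun w r hw => ?_
      have h1 : conj (preperspective φ s) (WithLp.toLp 2 (u, (ε * (conj φ u).toReal) • w)) ≤
          ((ε * (conj φ u).toReal * r : ℝ) : EReal) := by
        refine h.conj_preperspective_le_iff.2 ⟨hu, fun v t hv => ?_⟩
        have h1 := mul_le_mul_of_nonneg_left (le_conj hw hv) hpos.le
        simp only [WithLp.toLp_snd, WithLp.toLp_fst, inner_smul_right]
        rw [real_inner_comm] at h1
        linarith
      have h2 := le_conj h1 hz
      rw [inner_eq_fst_add_snd] at h2
      simp only [WithLp.toLp_fst, WithLp.toLp_snd, inner_smul_left, conj_trivial] at h2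
      rw [le_div_iff₀ hpos, real_inner_comm u]
      linarith
    obtain ⟨u₀, hu₀, hpos₀⟩ := h.exists_pos
    have htop : conj (conj k) z.snd < ⊤ := (key u₀ hu₀ hpos₀).trans_lt (EReal.coe_lt_top _)
    refine ⟨htop, fun u r hu => ?_⟩
    have hut : conj φ u < ⊤ := hu.trans_lt (EReal.coe_lt_top r)
    have h1 := mul_le_mul_of_nonpos_left (h.gamma0.conj.toReal_le hu) (h.nonpos _ htop)
    suffices inner ℝ z.fst u +
        (ε * (conj φ u).toReal) * (conj (conj k) z.snd).toReal ≤ c by nlinarith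
    rcases (h.nonneg u hut).eq_or_lt with h0 | hpos
    -- When `φ*(u) = 0` the test point `(u, 0)` suffices.
    · rw [← h0, zero_mul, add_zero]
      have h2 : conj (preperspective φ s) (WithLp.toLp 2 (u, 0)) ≤ ((0 : ℝ) : EReal) := by
        refine h.conj_preperspective_le_iff.2 ⟨hut, fun v t hv => ?_⟩
        simp [← h0]
      have h3 := le_conj h2 hz
      rw [inner_eq_fst_add_snd] at h3
      simp only [WithLp.toLp_fst, WithLp.toLp_snd, inner_zero_left] at h3
      rw [real_inner_comm]
      linarith
    · have h2 := h.gamma0_biconj.toReal_le (key u hut hpos)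
      rw [le_div_iff₀ hpos] at h2
      linarith
  · rintro ⟨htop, hz⟩
    refine conj_le_coe_iff.2 fun q r hq => ?_
    obtain ⟨hut, h1⟩ := h.conj_preperspective_le_iff.1 hq
    have h2 := h1 z.snd _ (h.gamma0_biconj.coe_toReal htop).ge
    have h3 := hz q.fst _ (h.gamma0.conj.coe_toReal hut).ge
    rw [inner_eq_fst_add_snd, real_inner_comm z.fst, real_inner_comm z.snd]
    nlinarith

/-- The coupled system of proximity operators characterizes the proximity operator of the
perspective. -/
theorem isProx_perspective (h : SignedPair φ s k ε) {x u : H} {y q : G} {γ : ℝ} (hγ : 0 < γ)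
    (hu : conj φ u < ⊤) (hq : conj (conj k) q < ⊤)
    (h₁ : IsProx (rscale (-ε * (conj (conj k) q).toReal / γ) (conj φ)) (γ⁻¹ • x) u)
    (h₂ : IsProx (rscale (γ * (ε * (conj φ u).toReal)) (conj (conj k))) y q) :
    IsProx (fun z => (γ : EReal) * perspective φ s z) (WithLp.toLp 2 (x, y))
      (WithLp.toLp 2 (x - γ • u, q)) := by
  have hb : 0 ≤ -ε * (conj (conj k) q).toReal := by linarith [h.nonpos q hq]
  rw [h.gamma0.conj.isProx_rscale_iff (by positivity) hu] at h₁
  rw [h.gamma0_biconj.isProx_rscale_iff (mul_nonneg hγ.le (h.nonneg u hu)) hq] at h₂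
  rw [← rscale_eq_mul hγ, h.gamma0_perspective.isProx_rscale_iff_conj hγ
    (g := WithLp.toLp 2 (u, γ⁻¹ • (y - q)))]
  swap
  · rw [← WithLp.toLp_sub, ← WithLp.toLp_smul]
    simp [smul_smul, hγ.ne']
  -- Bounds for the perspective and its conjugate; their cross terms cancel, so they sum to the
  -- inner product.
  refine ⟨inner ℝ (x - γ • u) u + ε * (conj (conj k) q).toReal * (conj φ u).toReal,
    inner ℝ q (γ⁻¹ • (y - q)) - ε * (conj φ u).toReal * (conj (conj k) q).toReal,
    h.perspective_le_iff.2 ⟨hq, fun u' r hu' => ?_⟩, ?_, ?_⟩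
  · have h1 := mul_le_mul_of_nonneg_left (h₁ u' r hu') hγ.le
    have h2 : x - γ • u = γ • (γ⁻¹ • x - u) := by
      rw [smul_sub, smul_smul, mul_inv_cancel₀ hγ.ne', one_smul]
    simp only [WithLp.toLp_snd, WithLp.toLp_fst]
    rw [h2, inner_smul_left, inner_smul_left, conj_trivial]
    rw [real_inner_comm, inner_sub_right] at h1
    have h3 : ∀ a b : ℝ, γ * (a / γ * b) = a * b := fun a b => by field_simp
    rw [mul_add, h3, h3] at h1
    linarith
  · rw [h.conj_perspective]
    refine h.conj_preperspective_le_iff.2 ⟨hu, fun v r hv => ?_⟩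
    have h1 := h₂ v r hv
    simp only [WithLp.toLp_snd, WithLp.toLp_fst, inner_smul_right]
    rw [inner_sub_left, mul_assoc γ, mul_assoc γ] at h1
    have h2 := mul_le_mul_of_nonneg_left h1 (inv_pos.2 hγ).le
    rw [mul_add, inv_mul_cancel_left₀ hγ.ne', inv_mul_cancel_left₀ hγ.ne'] at h2
    linarith
  · rw [inner_eq_fst_add_snd]
    simp only [WithLp.toLp_fst, WithLp.toLp_snd]
    linarith

theorem exists_isProx (h : SignedPair φ s k ε) (x : H) (y : G) {γ : ℝ} (hγ : 0 < γ) :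
    ∃ u q, conj φ u < ⊤ ∧ conj (conj k) q < ⊤ ∧
      IsProx (rscale (-ε * (conj (conj k) q).toReal / γ) (conj φ)) (γ⁻¹ • x) u ∧
      IsProx (rscale (γ * (ε * (conj φ u).toReal)) (conj (conj k))) y q := by
  obtain ⟨p, hp⟩ := (h.gamma0_perspective.rscale hγ.le).exists_isProx (WithLp.toLp 2 (x, y))
  obtain ⟨r, d, hr, hd, hrd⟩ := (h.gamma0_perspective.isProx_rscale_iff_conj hγ
    (g := WithLp.toLp 2 (γ⁻¹ • (x - p.fst), γ⁻¹ • (y - p.snd))) (by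
      rw [← WithLp.toLp_smul]
      simp only [Prod.smul_mk, smul_smul, mul_inv_cancel₀ hγ.ne', one_smul]
      rfl)).1 hp
  rw [h.conj_perspective] at hd
  obtain ⟨hq, hr⟩ := h.perspective_le_iff.1 hr
  obtain ⟨hu, hd⟩ := h.conj_preperspective_le_iff.1 hd
  rw [inner_eq_fst_add_snd] at hrd
  simp only [WithLp.toLp_fst, WithLp.toLp_snd] at hrd hd hu
  set u := γ⁻¹ • (x - p.fst)
  set w := γ⁻¹ • (y - p.snd)
  -- These two lower bounds for `r` and `d` sum to the inner product, which is at least `r + d`.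
  -- Both are therefore equalities, and the suprema are attained at `u` and `p.snd`.
  have hr₀ := hr u _ (h.gamma0.conj.coe_toReal hu).ge
  have hd₀ := hd p.snd _ (h.gamma0_biconj.coe_toReal hq).ge
  have hb : 0 ≤ -ε * (conj (conj k) p.snd).toReal := by linarith [h.nonpos p.snd hq]
  have hux : γ⁻¹ • x - u = γ⁻¹ • p.fst := by simp only [u, smul_sub]; abel
  have hwy : y - p.snd = γ • w := by
    simp only [w, smul_smul, mul_inv_cancel₀ hγ.ne', one_smul]
  refine ⟨u, p.snd, hu, hq, (h.gamma0.conj.isProx_rscale_iff (by positivity) hu).2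
    fun u' t hu' => ?_, (h.gamma0_biconj.isProx_rscale_iff
      (mul_nonneg hγ.le (h.nonneg u hu)) hq).2 fun v t hv => ?_⟩
  · have h1 := hr u' t hu'
    rw [hux, inner_smul_right, inner_sub_left, div_mul_eq_mul_div, div_mul_eq_mul_div,
      inv_mul_eq_div, ← add_div, div_le_div_iff_of_pos_right hγ, real_inner_comm,
      real_inner_comm p.fst u]
    nlinarith
  · have h1 := hd v t hv
    rw [hwy, inner_smul_right, mul_assoc γ, mul_assoc γ, ← mul_add, inner_sub_left]
    refine mul_le_mul_of_nonneg_left ?_ hγ.le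
    nlinarith

end SignedPair

end Perspective

/-! ### The three sign cases for the conjugate of the base function. -/

namespace Perspective

open Set Filter Topology

variable {H G : Type*} [NormedAddCommGroup H] [InnerProductSpace ℝ H]
  [NormedAddCommGroup G] [InnerProductSpace ℝ G]

theorem eq_neg_coe_of_add_coe_eq_zero {a : EReal} {η : ℝ} (h : a + (η : EReal) = 0) :
    a = ((-η : ℝ) : EReal) := by
  induction a with
  | bot => simp at h
  | top => simp at h
  | coe a =>
    have : a + η = 0 := by exact_mod_cast h
    rw [eq_neg_of_add_eq_zero_left this]

theorem negPart_neg_le_coe_iff {G : Type*} {s : G → EReal} {y : G} {r : ℝ} :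
    negPart (fun w => -s w) y ≤ r ↔ (0 < s y ∧ s y < ⊤) ∧ -1 * (s y).toReal ≤ r := by
  rw [negPart]
  induction s y with
  | bot => simp
  | top => simp
  | coe a =>
    rw [← EReal.coe_neg]
    by_cases ha : 0 < a <;> simp [ha, -EReal.coe_neg, EReal.bot_lt_coe, EReal.coe_le_coe_iff]

/-- The factor `- -1` is `-ε` at `ε = -1`, as `SignedPair.le_iff` requires. -/
theorem posPart_le_coe_iff {G : Type*} {s : G → EReal} {y : G} {r : ℝ} :
    posPart s y ≤ r ↔ (0 < s y ∧ s y < ⊤) ∧ - -1 * (s y).toReal ≤ r := by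
  unfold posPart
  induction s y with
  | bot => simp
  | top => simp
  | coe a => by_cases ha : 0 < a <;> simp [ha]

theorem le_negPart {G : Type*} (f : G → EReal) (y : G) : f y ≤ negPart f y := by
  unfold negPart
  split_ifs <;> simp

theorem SignedPair.of_conj_nonneg [CompleteSpace G] {φ : H → EReal} {s : G → EReal}
    (hφ : Gamma0 φ) (hS : (s ⁻¹' Ioo 0 ⊤).Nonempty) (h₁ : range (conj φ) ⊆ Ici 0)
    (h₂ : (conj φ ⁻¹' Ioo 0 ⊤).Nonempty) (hs : Gamma0 fun w => -s w) :
    SignedPair φ s (negPart fun w => -s w) 1 := by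
  have hk : ∃ w, ∃ c : ℝ, conj (negPart fun w => -s w) w ≤ c := by
    obtain ⟨w, c, hw⟩ := hs.exists_conj_le
    exact ⟨w, c, (conj_antitone (le_negPart _) w).trans hw⟩
  have hk' : ∃ y, ∃ r : ℝ, negPart (fun w => -s w) y ≤ r := by
    obtain ⟨y, hy⟩ := hS
    exact ⟨y, _, negPart_neg_le_coe_iff.2 ⟨hy, le_rfl⟩⟩
  have hh := Gamma0.conj_conj_of_exists hk' hk
  refine ⟨hφ, hS, one_mul 1, fun y r => negPart_neg_le_coe_iff, fun u _ => ?_, fun v hv => ?_, ?_,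
    hk⟩
  · rw [one_mul]
    exact EReal.toReal_nonneg (h₁ (mem_range_self u))
  -- This sublevel set is closed, convex and contains the domain of `(-s)^∨`, hence that of its
  -- biconjugate.
  · have hmem : v ∈ {v | conj (conj (negPart fun w => -s w)) v ≤ ((0 : ℝ) : EReal)} := by
      refine dom_conj_conj_subset hk hh.ne_bot (convex_setOf_le hh.convex 0) ?_ (fun w hw => ?_) hv
      · exact hh.lsc.isClosed_preimage _
      · refine (conj_conj_le _ w).trans ?_
        unfold negPart at hw ⊢
        split_ifs at hw ⊢ with hneg
        · exact hneg.2.le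
        · exact absurd hw (lt_irrefl _)
    rw [one_mul]
    exact hh.toReal_le hmem
  · obtain ⟨u, hu⟩ := h₂
    refine ⟨u, hu.2, ?_⟩
    rw [one_mul]
    exact EReal.toReal_pos hu.1 hu.2.ne

theorem SignedPair.of_conj_nonpos {φ : H → EReal} {s : G → EReal}
    (hφ : Gamma0 φ) (hS : (s ⁻¹' Ioo 0 ⊤).Nonempty) (h₁ : range (conj φ) ⊆ Ioc ⊥ 0 ∪ {⊤})
    (h₂ : (conj φ ⁻¹' Ioo ⊥ 0).Nonempty) : SignedPair φ s (posPart s) (-1) := by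
  have hk : conj (posPart s) 0 ≤ ((0 : ℝ) : EReal) := by
    refine conj_le_coe_iff.2 fun y r hr => ?_
    obtain ⟨hy, hr⟩ := posPart_le_coe_iff.1 hr
    have := EReal.toReal_nonneg hy.1.le
    rw [inner_zero_right]
    linarith
  refine ⟨hφ, hS, by norm_num, fun y r => posPart_le_coe_iff, fun u hu => ?_, fun v hv => ?_, ?_,
    ⟨0, 0, hk⟩⟩
  · rcases h₁ (mem_range_self u) with h | h
    · linarith [EReal.toReal_nonpos h.2]
    · exact absurd h hu.ne
  -- The zero function is an affine minorant of `s^∧`.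
  · have h0 : 0 ≤ conj (conj (posPart s)) v := by
      refine ereal_le_of_forall_coe fun c hc => ?_
      have := le_conj hk hc
      rw [inner_zero_left] at this
      exact_mod_cast (by linarith : (0 : ℝ) ≤ c)
    linarith [EReal.toReal_nonneg h0]
  · obtain ⟨u, hu⟩ := h₂
    refine ⟨u, hu.2.trans EReal.zero_lt_top, ?_⟩
    have h3 : conj φ u = (((conj φ u).toReal : ℝ) : EReal) :=
      (EReal.coe_toReal (hu.2.trans EReal.zero_lt_top).ne hu.1.ne').symm
    have h4 := hu.2
    rw [h3] at h4
    have h5 : (conj φ u).toReal < 0 := by exact_mod_cast h4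
    linarith

variable [CompleteSpace H] [CompleteSpace G]

/-- The conjugate of the preperspective is the indicator of `dom φ*` in `u` plus the support
function of `S` in `w`, so Fenchel–Young separates. -/
theorem isProx_perspective_of_conj_eq_ind {φ : H → EReal} (hφ : Gamma0 φ) {s : G → EReal}
    (hS : (s ⁻¹' Ioo 0 ⊤).Nonempty) (h : range (conj φ) ⊆ {0, ⊤}) (x : H) (y : G) {γ : ℝ}
    (hγ : 0 < γ) : Gamma0 (perspective φ s) ∧
      IsProx (fun z => (γ : EReal) * perspective φ s z) (WithLp.toLp 2 (x, y))
        (WithLp.toLp 2 (prox (fun w => (γ : EReal) * φ w) x,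
          proj (closedConvexHull ℝ (s ⁻¹' Ioo 0 ⊤)) y)) := by
  have hzero : ∀ u, conj φ u < ⊤ → (conj φ u).toReal = 0 := fun u hu => by
    rcases h (mem_range_self u) with h | h
    · rw [h, EReal.toReal_zero]
    · exact absurd h hu.ne
  have hconj : ∀ (z : WithLp 2 (H × G)) (c : ℝ), conj (preperspective φ s) z ≤ c ↔
      conj φ z.fst < ⊤ ∧ ∀ y ∈ s ⁻¹' Ioo 0 ⊤, inner ℝ y z.snd ≤ c := fun z c => by
    rw [conj_preperspective_le_coe_iff hφ.exists_le_coe hS]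
    refine and_congr_right fun hu => ?_
    simp [hzero _ hu]
  have hex : ∃ z, ∃ c : ℝ, conj (preperspective φ s) z ≤ c := by
    obtain ⟨u, c, hu⟩ := hφ.exists_conj_le
    exact ⟨WithLp.toLp 2 (u, 0), 0, (hconj _ _).2 ⟨hu.trans_lt (EReal.coe_lt_top c), by simp⟩⟩
  have hP := exists_preperspective_le hφ.exists_le_coe hS
  have hF : Gamma0 (perspective φ s) := gamma0_lscConvexEnv hP hex
  have hFeq : perspective φ s = conj (conj (preperspective φ s)) := lscConvexEnv_eq_conj_conj hP hex
  refine ⟨hF, ?_⟩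
  set C : Set G := closedConvexHull ℝ (s ⁻¹' Ioo 0 ⊤)
  have hCcl : IsClosed C := isClosed_closedConvexHull
  have hSC : s ⁻¹' Ioo 0 ⊤ ⊆ C := subset_closedConvexHull
  have hCΓ : Gamma0 (ind C) := gamma0_ind (hS.mono hSC) hCcl convex_closedConvexHull
  set p := prox (fun w => (γ : EReal) * φ w) x
  set q := proj C y
  have hp : IsProx (rscale γ φ) x p := by
    have := (hφ.rscale hγ.le).isProx_prox x
    rwa [rscale_eq_mul hγ] at this ⊢
  have hq : ind C q < ⊤ ∧ ∀ z, ∀ t : ℝ, ind C z ≤ t →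
      (ind C q).toReal + inner ℝ (z - q) (y - q) ≤ t := hCΓ.subgradient_of_isProx (hCΓ.isProx_prox y)
  have hqC : q ∈ C := by
    by_contra hqC
    have := hq.1
    simp only [ind] at this
    rw [if_neg hqC] at this
    exact this.ne rfl
  have hqn : ∀ v ∈ C, inner ℝ (v - q) (y - q) ≤ 0 := fun v hv => by
    have := hq.2 v 0 (ind_le_coe_iff.2 ⟨hv, le_rfl⟩)
    have h0 : ind C q = 0 := by simp [ind, hqC]
    change (ind C q).toReal + inner ℝ (v - q) (y - q) ≤ 0 at this
    rwa [h0, EReal.toReal_zero, zero_add] at this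
  obtain ⟨r, d, hr, hd, hrd⟩ := (hφ.isProx_rscale_iff_conj hγ (g := γ⁻¹ • (x - p)) (by
    rw [smul_smul, mul_inv_cancel₀ hγ.ne', one_smul])).1 hp
  rw [← rscale_eq_mul hγ, hF.isProx_rscale_iff_conj hγ
    (g := WithLp.toLp 2 (γ⁻¹ • (x - p), γ⁻¹ • (y - q)))]
  swap
  · rw [← WithLp.toLp_sub, ← WithLp.toLp_smul]
    simp [smul_smul, hγ.ne']
  -- The value `r` bounds `φ p`; the support function of `C` at `w = (y - q)/γ` is attained at the
  -- projection `q`.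
  refine ⟨r, inner ℝ q (γ⁻¹ • (y - q)), ?_, ?_, ?_⟩
  · rw [hFeq]
    refine conj_le_coe_iff.2 fun g t hg => ?_
    obtain ⟨hu, hg⟩ := (hconj _ _).1 hg
    have h1 := le_conj hr (hφ.conj.coe_toReal hu).ge
    have h2 : q ∈ {v : G | inner ℝ v g.snd ≤ t} := by
      refine closedConvexHull_min (t := {v : G | inner ℝ v g.snd ≤ t}) hg (fun a ha b hb α β hα hβ hαβ => ?_) ?_ hqC
      · simp only [mem_ofPred_eq, inner_add_left, inner_smul_left, conj_trivial] at ha hb ⊢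
        have : t = α * t + β * t := by rw [← add_mul, hαβ, one_mul]
        nlinarith [mul_le_mul_of_nonneg_left ha hα, mul_le_mul_of_nonneg_left hb hβ]
      · refine isClosed_le ?_ ?_ <;> fun_prop
    simp only [mem_ofPred_eq] at h2
    rw [hzero _ hu] at h1
    rw [inner_eq_fst_add_snd, real_inner_comm _ g.fst, real_inner_comm _ g.snd]
    simp only [WithLp.toLp_fst, WithLp.toLp_snd]
    linarith
  · rw [hFeq, (Gamma0.conj_of_exists hP hex).conj_conj_eq, hconj]
    refine ⟨hd.trans_lt (EReal.coe_lt_top d), fun v hv => ?_⟩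
    have h1 := hqn v (hSC hv)
    rw [inner_sub_left] at h1
    simp only [WithLp.toLp_snd, inner_smul_right]
    exact mul_le_mul_of_nonneg_left (by linarith) (inv_pos.2 hγ).le
  · have h0 : 0 ≤ d := by
      have h1 : conj φ (γ⁻¹ • (x - p)) < ⊤ := hd.trans_lt (EReal.coe_lt_top d)
      rw [← hzero _ h1]
      exact hφ.conj.toReal_le hd
    rw [inner_eq_fst_add_snd]
    simp only [WithLp.toLp_fst, WithLp.toLp_snd]
    linarith

end Perspective

/-! ### Existence and uniqueness of `η`. -/

theorem theorem4p1 {H G : Type*}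
    [NormedAddCommGroup H] [InnerProductSpace ℝ H] [CompleteSpace H]
    [NormedAddCommGroup G] [InnerProductSpace ℝ G] [CompleteSpace G]
    (φ : H → EReal) (hφ : Perspective.Gamma0 φ)
    (s : G → EReal) (hS : (s ⁻¹' Set.Ioo 0 ⊤).Nonempty)
    (x : H) (y : G) (γ : ℝ) (hγ : 0 < γ) :
    -- the conjugate of the base function is nonnegative
    (Set.range (Perspective.conj φ) ⊆ Set.Ici 0 →
      (Perspective.conj φ ⁻¹' Set.Ioo 0 ⊤).Nonempty →
      Perspective.Gamma0 (fun w => -s w) →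
      ∀ (u : ℝ → H) (v : ℝ → G),
      (∀ η, u η =
        Perspective.prox (Perspective.rscale (η / γ) (Perspective.conj φ)) (γ⁻¹ • x)) →
      (∀ η, v η =
        Perspective.prox (Perspective.rscale (γ * (Perspective.conj φ (u η)).toReal)
          (Perspective.lowerEnv (fun w => -s w))) y) →
      Perspective.Gamma0 (Perspective.perspective φ s) ∧
      (∃! η : ℝ, 0 ≤ η ∧ Perspective.conj φ (u η) < ⊤ ∧
        Perspective.lowerEnv (fun w => -s w) (v η) + (η : EReal) = 0) ∧
      ∀ η : ℝ, 0 ≤ η → Perspective.conj φ (u η) < ⊤ →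
        Perspective.lowerEnv (fun w => -s w) (v η) + (η : EReal) = 0 →
        Perspective.IsProx (fun z => (γ : EReal) * Perspective.perspective φ s z)
          (WithLp.toLp 2 (x, y)) (WithLp.toLp 2 (x - γ • u η, v η))) ∧
    -- the conjugate only takes the values zero and plus infinity
    (Set.range (Perspective.conj φ) ⊆ {0, ⊤} →
      Perspective.Gamma0 (Perspective.perspective φ s) ∧
      Perspective.IsProx (fun z => (γ : EReal) * Perspective.perspective φ s z)
        (WithLp.toLp 2 (x, y))
        (WithLp.toLp 2 (Perspective.prox (fun w => (γ : EReal) * φ w) x,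
          Perspective.proj (closedConvexHull ℝ (s ⁻¹' Set.Ioo 0 ⊤)) y))) ∧
    -- the conjugate is nonpositive on its domain
    (Set.range (Perspective.conj φ) ⊆ Set.Ioc ⊥ 0 ∪ {⊤} →
      (Perspective.conj φ ⁻¹' Set.Ioo ⊥ 0).Nonempty →
      Perspective.Gamma0 s →
      ∀ (v : ℝ → G) (u : ℝ → H),
      (∀ η, v η =
        Perspective.prox (Perspective.rscale (γ * η) (Perspective.upperEnv s)) y) →
      (∀ η, u η =
        Perspective.prox (Perspective.rscale
          (1 / γ * (Perspective.upperEnv s (v η)).toReal) (Perspective.conj φ)) (γ⁻¹ • x)) →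
      Perspective.Gamma0 (Perspective.perspective φ s) ∧
      (∃! η : ℝ, 0 ≤ η ∧ Perspective.upperEnv s (v η) < ⊤ ∧
        Perspective.conj φ (u η) + (η : EReal) = 0) ∧
      ∀ η : ℝ, 0 ≤ η → Perspective.upperEnv s (v η) < ⊤ →
        Perspective.conj φ (u η) + (η : EReal) = 0 →
        Perspective.IsProx (fun z => (γ : EReal) * Perspective.perspective φ s z)
          (WithLp.toLp 2 (x, y)) (WithLp.toLp 2 (x - γ • u η, v η))) := by
  refine ⟨fun h₁ h₂ hs u v hu hv => ?_,
    fun h => Perspective.isProx_perspective_of_conj_eq_ind hφ hS h x y hγ,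
    fun h₁ h₂ _ v u hv hu => ?_⟩
  · have h := Perspective.SignedPair.of_conj_nonneg hφ hS h₁ h₂ hs
    have key : ∀ η : ℝ, 0 ≤ η → Perspective.conj φ (u η) < ⊤ →
        Perspective.lowerEnv (fun w => -s w) (v η) + (η : EReal) = 0 →
        Perspective.IsProx (fun z => (γ : EReal) * Perspective.perspective φ s z)
          (WithLp.toLp 2 (x, y)) (WithLp.toLp 2 (x - γ • u η, v η)) := by
      intro η hη hut hve
      have hvη := Perspective.eq_neg_coe_of_add_coe_eq_zero hve
      have hvt : Perspective.lowerEnv (fun w => -s w) (v η) < ⊤ := hvη ▸ EReal.coe_lt_top _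
      have hre : (Perspective.lowerEnv (fun w => -s w) (v η)).toReal = -η := by
        rw [hvη, EReal.toReal_coe]
      refine h.isProx_perspective hγ hut hvt ?_ ?_
      · have hpr := (hφ.conj.rscale (div_nonneg hη hγ.le)).isProx_prox (γ⁻¹ • x)
        rw [← hu η] at hpr
        change Perspective.IsProx (Perspective.rscale
          (-1 * (Perspective.lowerEnv (fun w => -s w) (v η)).toReal / γ) _) _ _
        rwa [hre, neg_one_mul, neg_neg]
      · have hpr := (h.gamma0_biconj.rscale (mul_nonneg hγ.le (h.nonneg _ hut))).isProx_prox y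
        rw [one_mul] at hpr ⊢
        have hv' := hv η
        unfold Perspective.lowerEnv at hv'
        rwa [← hv'] at hpr
    refine ⟨h.gamma0_perspective, ?_, key⟩
    obtain ⟨u₀, q₀, hu₀, hq₀, hpu, hpq⟩ := h.exists_isProx x y hγ
    set η₀ : ℝ := -(Perspective.conj (Perspective.conj
      (Perspective.negPart fun w => -s w)) q₀).toReal with hη₀
    have hη₀' : 0 ≤ η₀ := by linarith [h.nonpos q₀ hq₀]
    have hue : u η₀ = u₀ := by
      rw [hu, hη₀, ← neg_one_mul, hpu.prox_eq]
    have hve : v η₀ = q₀ := by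
      rw [one_mul] at hpq
      rw [hv, hue]
      exact hpq.prox_eq
    have hsol : Perspective.lowerEnv (fun w => -s w) (v η₀) + (η₀ : EReal) = 0 := by
      rw [hve, Perspective.lowerEnv, ← h.gamma0_biconj.coe_toReal hq₀, hη₀, ← EReal.coe_add,
        add_neg_cancel, EReal.coe_zero]
    have hut : Perspective.conj φ (u η₀) < ⊤ := hue ▸ hu₀
    refine ⟨η₀, ⟨hη₀', hut, hsol⟩, ?_⟩
    rintro η ⟨hη, hη', hηs⟩
    -- Two solutions give the same proximal point, hence the same `v`, and `η` is minus the envelope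
    -- at `v`.
    have heq := (key η₀ hη₀' hut hsol).2 _ (key η hη hη' hηs).1
    have hsnd : v η = v η₀ := congrArg WithLp.snd heq
    have e1 := Perspective.eq_neg_coe_of_add_coe_eq_zero hηs
    rw [hsnd, Perspective.eq_neg_coe_of_add_coe_eq_zero hsol] at e1
    exact neg_injective (EReal.coe_injective e1).symm
  · have h := Perspective.SignedPair.of_conj_nonpos hφ hS h₁ h₂
    have key : ∀ η : ℝ, 0 ≤ η → Perspective.upperEnv s (v η) < ⊤ →
        Perspective.conj φ (u η) + (η : EReal) = 0 →
        Perspective.IsProx (fun z => (γ : EReal) * Perspective.perspective φ s z)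
          (WithLp.toLp 2 (x, y)) (WithLp.toLp 2 (x - γ • u η, v η)) := by
      intro η hη hvt hue
      have huη := Perspective.eq_neg_coe_of_add_coe_eq_zero hue
      have hut : Perspective.conj φ (u η) < ⊤ := huη ▸ EReal.coe_lt_top _
      have hre : (Perspective.conj φ (u η)).toReal = -η := by rw [huη, EReal.toReal_coe]
      have hnn : 0 ≤ (Perspective.upperEnv s (v η)).toReal := by
        have := h.nonpos _ hvt
        change -1 * (Perspective.upperEnv s (v η)).toReal ≤ 0 at this
        linarith
      refine h.isProx_perspective hγ hut hvt ?_ ?_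
      · have hpr := (hφ.conj.rscale (mul_nonneg (one_div_pos.2 hγ).le hnn)).isProx_prox (γ⁻¹ • x)
        rw [← hu η] at hpr
        change Perspective.IsProx (Perspective.rscale
          (- -1 * (Perspective.upperEnv s (v η)).toReal / γ) _) _ _
        rwa [neg_neg, one_mul, div_eq_mul_one_div, mul_comm]
      · have hpr := (h.gamma0_biconj.rscale (mul_nonneg hγ.le hη)).isProx_prox y
        have hv' := hv η
        unfold Perspective.upperEnv at hv'
        rw [← hv'] at hpr
        rwa [hre, neg_one_mul, neg_neg]
    refine ⟨h.gamma0_perspective, ?_, key⟩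
    obtain ⟨u₀, q₀, hu₀, hq₀, hpu, hpq⟩ := h.exists_isProx x y hγ
    set η₀ : ℝ := -(Perspective.conj φ u₀).toReal with hη₀
    have hη₀' : 0 ≤ η₀ := by linarith [h.nonneg u₀ hu₀]
    have hve : v η₀ = q₀ := by
      rw [neg_one_mul] at hpq
      rw [hv, hη₀]
      exact hpq.prox_eq
    have hue : u η₀ = u₀ := by
      rw [neg_neg, one_mul, div_eq_mul_one_div, mul_comm] at hpu
      rw [hu, hve]
      exact hpu.prox_eq
    have hsol : Perspective.conj φ (u η₀) + (η₀ : EReal) = 0 := by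
      rw [hue, ← hφ.conj.coe_toReal hu₀, hη₀, ← EReal.coe_add, add_neg_cancel, EReal.coe_zero]
    have hvt : Perspective.upperEnv s (v η₀) < ⊤ := hve ▸ hq₀
    refine ⟨η₀, ⟨hη₀', hvt, hsol⟩, ?_⟩
    rintro η ⟨hη, hη', hηs⟩
    -- Here the first component determines `u` since `γ ≠ 0`, and `η = -φ*(u)`.
    have heq := (key η₀ hη₀' hvt hsol).2 _ (key η hη hη' hηs).1
    have hfst : x - γ • u η = x - γ • u η₀ := congrArg WithLp.fst heq
    have hueq : u η = u η₀ := smul_right_injective H hγ.ne' (sub_right_injective hfst)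
    have e1 := Perspective.eq_neg_coe_of_add_coe_eq_zero hηs
    rw [hueq, Perspective.eq_neg_coe_of_add_coe_eq_zero hsol] at e1
    exact neg_injective (EReal.coe_injective e1).symm
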